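/- Let $(s_n)_{n\ge 0} = 1, 1, 3, 11, 45, 197, \dots$ be the little Schröder numbers. All trees are ordered (plane) rooted trees; a \emph{generator} of a tree is a vertex that is a leaf (outdegree $0$) or has outdegree $1$, and the one-vertex tree has exactly one leaf. For $j\ge 1$ let $\mathcal{ST}_{j-1}$ be the set of ordered rooted trees with $j$ leaves and no vertex of outdegree $1$. \textbf{Theorem.} For every $j\ge 1$, $\#\mathcal{ST}_{j-1}=s_{j-1}$. For every $n\ge 1$, the set $\mathcal{T}_n$ of ordered rooted trees with $n$ generators is in one-to-one correspondence with the set of Dyck paths of semilength $n$ in which each ascent (maximal run of up-steps) of length $j$ is colored in one of $s_{j-1}$ colors. More precisely, taking as colors of a $j$-ascent the elements of $\mathcal{ST}_{j-1}$, the following map $\psi$ is a bijection from the set of colored Dyck paths of semilength $n$ onto $\mathcal{T}_n$. Let $P$ be a colored Dyck path with ascents colored $G_1,\dots,G_k$, and with descents (maximal runs of down-steps) of lengths $j_1,\dots,j_k$, both listed from left to right. Start at the root of $G_1$ and traverse the tree in depth-first, left-to-right order until its $j_1$-th leaf is reached; add an edge from that leaf to the root of $G_2$, so that the root of $G_2$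 is its only child. From that node, which is no longer a leaf, continue the traversal of the augmented tree until the $j_2$-th leaf after it is reached, attach $G_3$ there in the same way, and so on until $G_k$ has been attached (the last descent $j_k$ is not used). The resulting tree is $\psi(P)$. -/

import Mathlib

/-- Ordered (plane) rooted trees: a root together with the list, from left to right, of the
subtrees hanging from its children. -/
inductive OrderedTree : Type
  | node : List OrderedTree → OrderedTree

namespace OrderedTree

/-- The outdegree (number of children) of the root. -/
def outdegree : OrderedTree → ℕ
  | node ts => ts.length

/-- The list of all vertices of a tree in depth-first order, each vertex being represented by the
subtree rooted at it (so one entry for every vertex, with repetitions). -/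
def vertices : OrderedTree → List OrderedTree
  | node ts => node ts :: go ts
where
  go : List OrderedTree → List OrderedTree
    | [] => []
    | t :: ts => t.vertices ++ go ts

/-- The number of leaves, i.e. of vertices of outdegree 0. A one-vertex tree has one leaf. -/
def leaves (t : OrderedTree) : ℕ := t.vertices.countP (fun v => v.outdegree = 0)

/-- The number of generators, i.e. of vertices that are leaves or have outdegree 1. -/
def generators (t : OrderedTree) : ℕ :=
  t.vertices.countP (fun v => v.outdegree = 0 ∨ v.outdegree = 1)

/-- No vertex of the tree has outdegree 1. -/
def NoUnary (t : OrderedTree) : Prop := ∀ v ∈ t.vertices, v.outdegree ≠ 1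

/-- `graft g t i` adds an edge between the leaf of `t` that is preceded by exactly `i` leaves in
the depth-first (left to right) order and the root of `g`, so that this leaf becomes a vertex
whose only child is the root of `g`. If there is no such leaf, `t` is unchanged. -/
def graft (g : OrderedTree) : OrderedTree → ℕ → OrderedTree
  | node [], 0 => node [g]
  | node [], _ + 1 => node []
  | node (t :: ts), i => node (go (t :: ts) i)
where
  go : List OrderedTree → ℕ → List OrderedTree
    | [], _ => []
    | t :: ts, i => if i < t.leaves then graft g t i :: ts else t :: go ts (i - t.leaves)

end OrderedTree

/-- The ordered trees with `j` leaves and no vertex of outdegree 1. -/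
def SchroderTree (j : ℕ) : Type := {t : OrderedTree // t.leaves = j ∧ t.NoUnary}

/-- The little Schröder numbers 1, 1, 3, 11, 45, 197, ..., indexed from 0. (`Nat.smallSchroder`
is the same sequence with an additional initial term 1.) -/
def littleSchroder (n : ℕ) : ℕ := Nat.smallSchroder (n + 1)

namespace DyckWord

/-- The lengths, from left to right, of the maximal runs of the step `s` in a Dyck path. -/
def runLengths (s : DyckStep) (p : DyckWord) : List ℕ :=
  ((p.toList.splitBy (fun a b => a == b)).filter (fun r => s ∈ r)).map List.length

/-- The lengths of the ascents (maximal runs of up-steps). -/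
def ascents (p : DyckWord) : List ℕ := p.runLengths DyckStep.U

/-- The lengths of the descents (maximal runs of down-steps). In a Dyck path the `i`-th descent
immediately follows the `i`-th ascent. -/
def descents (p : DyckWord) : List ℕ := p.runLengths DyckStep.D

end DyckWord

/-- Dyck paths of semilength `n` in which every ascent carries a colour, the colours available to
an ascent of length `j` being the elements of `C j`. -/
structure ColoredDyckPath (C : ℕ → Type) (n : ℕ) where
  path : DyckWord
  semilength_eq : path.semilength = n
  color : (i : Fin path.ascents.length) → C (path.ascents.get i)

namespace ColoredDyckPath

/-- One step of the insertion algorithm. The state consists of the tree `s.1` built so far and the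
number `s.2` of its leaves that precede the current position of the traversal; when the next
descent has length `d.1`, the traversal moves on to the `d.1`-th leaf from that position, and the
tree `d.2` is attached below that leaf, which becomes the new position. -/
def insertStep (s : OrderedTree × ℕ) (d : ℕ × OrderedTree) : OrderedTree × ℕ :=
  (OrderedTree.graft d.2 s.1 (s.2 + (d.1 - 1)), s.2 + (d.1 - 1))

/-- The insertion algorithm for trees `G₁, G₂, …, Gₖ` and descents `j₁, j₂, …`: start at the root of
`G₁`, and successively insert `Gᵢ₊₁` at the `jᵢ`-th leaf from the current position.
The value for the empty list of trees is immaterial. -/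
def insertAll (js : List ℕ) : List OrderedTree → OrderedTree
  | [] => .node []
  | G :: Gs => ((js.zip Gs).foldl insertStep (G, 0)).1

/-- The ordered tree built by the insertion algorithm from a Dyck path each of whose ascents of
length `j` is coloured by an ordered tree with `j` leaves and no vertex of outdegree 1. -/
def toTree {n : ℕ} (P : ColoredDyckPath SchroderTree n) : OrderedTree :=
  insertAll P.path.descents (List.ofFn fun i => (P.color i).1)

end ColoredDyckPath

/-! ### Depth-first words of outdegrees. -/

namespace OrderedTree

/-! A tree is encoded by its depth-first word of outdegrees, a prefix code (`word_append_inj`).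
Grafting `g` at a leaf replaces one letter 0 by 1 followed by the word of `g` (`word_graft`).
`Insertion` records a run of the algorithm with the word cut at the current position. The colours
contain no letter 1, so the position is always just after the last 1. Hence the last graft can be
read off and undone: the run is unique (`Insertion.inj`), and every tree arises from one
(`Insertion.exists_of_tree`). A graft turns a leaf into a unary vertex, so generators count the
leaves of all colours, that is, the up-steps. The number of leaves from the position on equals the
height of the path after its latest ascent. So a run can be carried out exactly when the path stays
nonnegative (`Insertion.isBallot`, `exists_insertion_of_isBallot`), and the final descent is forced.
The colours are counted by cutting off the first subtree of the root, which gives the Schröder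
recurrence for forests. -/

theorem induction_on {motive : OrderedTree → Prop} (t : OrderedTree)
    (node : ∀ ts, (∀ t ∈ ts, motive t) → motive (node ts)) : motive t :=
  OrderedTree.rec (motive_1 := motive) (motive_2 := fun ts => ∀ t ∈ ts, motive t)
    (fun ts h => node ts h) (by simp) (fun t ts h hs => by simpa using ⟨h, hs⟩) t

/-- The outdegrees of the vertices of a tree, in depth-first order. -/
def word (t : OrderedTree) : List ℕ := t.vertices.map outdegree

/-- The concatenation of the words of the trees of a forest. -/
def forestWord (ts : List OrderedTree) : List ℕ := ts.flatMap word

@[simp] theorem forestWord_nil : forestWord [] = [] := rfl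

@[simp] theorem forestWord_cons (t : OrderedTree) (ts : List OrderedTree) :
    forestWord (t :: ts) = t.word ++ forestWord ts := rfl

theorem map_outdegree_vertices_go (ts : List OrderedTree) :
    (vertices.go ts).map outdegree = forestWord ts := by
  induction ts with
  | nil => simp [vertices.go]
  | cons t ts ih => simp [vertices.go, ih, word]

@[simp] theorem word_node (ts : List OrderedTree) :
    (node ts).word = ts.length :: forestWord ts := by
  simp [word, vertices, map_outdegree_vertices_go, outdegree]

theorem leaves_eq_count (t : OrderedTree) : t.leaves = t.word.count 0 := by
  simp only [leaves, word, List.count, List.countP_map, Function.comp_def, beq_eq_decide]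

theorem generators_eq_count (t : OrderedTree) :
    t.generators = t.word.count 0 + t.word.count 1 := by
  unfold generators word
  induction t.vertices with
  | nil => rfl
  | cons v vs ih =>
    simp only [List.countP_cons, ih, List.map_cons, List.count_cons]
    rcases v.outdegree with _ | _ | k <;> simp <;> omega

theorem noUnary_iff (t : OrderedTree) : t.NoUnary ↔ 1 ∉ t.word := by
  simp [NoUnary, word]

theorem noUnary_node (ts : List OrderedTree) :
    (node ts).NoUnary ↔ ts.length ≠ 1 ∧ ∀ t ∈ ts, t.NoUnary := by
  simp only [noUnary_iff, word_node, List.mem_cons, not_or, forestWord, List.mem_flatMap, not_exists,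
    not_and]
  exact and_congr_left' ne_comm

theorem count_forestWord (ts : List OrderedTree) :
    (forestWord ts).count 0 = (ts.map leaves).sum := by
  induction ts with
  | nil => rfl
  | cons t ts ih => simp [ih, leaves_eq_count]

theorem leaves_node_cons (t : OrderedTree) (ts : List OrderedTree) :
    (node (t :: ts)).leaves = ((t :: ts).map leaves).sum := by
  rw [leaves_eq_count, word_node, List.count_cons_of_ne (by simp), count_forestWord]

@[simp] theorem leaves_node_nil : (node []).leaves = 1 := by
  simp [leaves_eq_count]

theorem leaves_pos (t : OrderedTree) : 0 < t.leaves := by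
  induction t using induction_on with
  | node ts ih =>
    cases ts with
    | nil => simp
    | cons t ts =>
      rw [leaves_node_cons]
      have := ih t (by simp)
      simp; omega

/-- The words of trees form a prefix code. -/
theorem word_append_inj (t : OrderedTree) :
    ∀ {t' : OrderedTree} {r r' : List ℕ}, t.word ++ r = t'.word ++ r' → t = t' ∧ r = r' := by
  induction t using induction_on with
  | node ts ih =>
    rintro ⟨ts'⟩ r r' h
    simp only [word_node, List.cons_append, List.cons.injEq] at h
    obtain ⟨hl, h⟩ := h
    suffices ts = ts' ∧ r = r' by simpa using this
    induction ts generalizing ts' with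
    | nil =>
      obtain rfl : ts' = [] := by simpa using hl.symm
      simpa using h
    | cons t ts ihs =>
      obtain _ | ⟨t', ts'⟩ := ts'
      · simp at hl
      simp only [forestWord_cons, List.append_assoc] at h
      obtain rfl := (ih t (by simp) h).1
      obtain ⟨rfl, rfl⟩ := ihs (fun t ht => ih t (by simp [ht])) ts' (by simpa using hl)
        (ih t (by simp) h).2
      simp

theorem word_injective : Function.Injective word := fun t t' h =>
  (word_append_inj t (r := []) (r' := []) (by simpa using h)).1

/-- Every nonempty suffix of the word of a tree starts with the word of a subtree, and this subtree
can be replaced by an arbitrary tree. -/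
theorem exists_subtree (t : OrderedTree) : ∀ {u v : List ℕ}, t.word = u ++ v → v ≠ [] →
    ∃ g y, v = word g ++ y ∧ ∀ g', ∃ t', word t' = u ++ (word g' ++ y) := by
  induction t using induction_on with
  | node ts ih =>
    intro u v h hv
    obtain _ | ⟨k, u⟩ := u
    · exact ⟨node ts, [], by simpa using h.symm, fun g' => ⟨g', by simp⟩⟩
    simp only [word_node, List.cons_append, List.cons.injEq] at h
    obtain ⟨rfl, h⟩ := h
    suffices ∃ g y, v = word g ++ y ∧ ∀ g', ∃ ts' : List OrderedTree, ts'.length = ts.length ∧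
        forestWord ts' = u ++ (word g' ++ y) by
      obtain ⟨g, y, hy, hg⟩ := this
      refine ⟨g, y, hy, fun g' => ?_⟩
      obtain ⟨ts', hl, hw⟩ := hg g'
      exact ⟨node ts', by simp [hl, hw]⟩
    induction ts generalizing u with
    | nil => simp_all
    | cons t ts ihs =>
      rw [forestWord_cons] at h
      have later : ∀ u', u = t.word ++ u' → forestWord ts = u' ++ v →
          ∃ g y, v = word g ++ y ∧ ∀ g', ∃ ts' : List OrderedTree,
            ts'.length = (t :: ts).length ∧ forestWord ts' = u ++ (word g' ++ y) := by
        rintro u' rfl hu'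
        obtain ⟨g, y, hy, hg⟩ := ihs (fun t ht => ih t (by simp [ht])) u' hu'
        refine ⟨g, y, hy, fun g' => ?_⟩
        obtain ⟨ts', hl, hw⟩ := hg g'
        exact ⟨t :: ts', by simp [hl], by simp [hw]⟩
      obtain ⟨u', hu, hv'⟩ | ⟨v', ht, hv'⟩ := List.append_eq_append_iff.1 h
      · exact later u' hu hv'
      -- If the cut falls exactly between two trees, the subtree sought lies in the remaining
      -- forest.
      · obtain rfl | hne := eq_or_ne v' []
        · exact later [] (by simpa using ht.symm) (by simpa using hv'.symm)
        obtain ⟨g, y, rfl, hg⟩ := ih t (by simp) ht hne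
        refine ⟨g, y ++ forestWord ts, by simp [hv'], fun g' => ?_⟩
        obtain ⟨t', ht'⟩ := hg g'
        exact ⟨t' :: ts, by simp, by simp [ht']⟩

/-- The leaf at the displayed 0 is preceded by `u.count 0` leaves. This turns grafting into a
substitution in words. -/
theorem word_graft (g t : OrderedTree) : ∀ {u y : List ℕ}, t.word = u ++ 0 :: y →
    (graft g t (u.count 0)).word = u ++ 1 :: (g.word ++ y) := by
  induction t using induction_on with
  | node ts ih =>
    intro u y h
    obtain _ | ⟨t, ts⟩ := ts
    · have : u = [] ∧ y = [] := by
        obtain _ | ⟨k, u⟩ := u <;> simp_all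
      obtain ⟨rfl, rfl⟩ := this
      simp [graft]
    obtain _ | ⟨k, u⟩ := u
    · simp at h
    rw [word_node, List.cons_append, List.cons.injEq] at h
    obtain ⟨rfl, h⟩ := h
    rw [List.count_cons_of_ne (by simp), graft, word_node, List.cons_append, List.cons.injEq]
    -- Nonemptiness only selected the branch of `graft`; it is dropped so that induction on the
    -- forest applies.
    generalize t :: ts = ts at *
    induction ts generalizing u with
    | nil => simp at h
    | cons t ts ihs =>
      rw [forestWord_cons] at h
      have later : ∀ u', u = t.word ++ u' → forestWord ts = u' ++ 0 :: y →
          (graft.go g (t :: ts) (u.count 0)).length = (t :: ts).length ∧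
            forestWord (graft.go g (t :: ts) (u.count 0)) = u ++ 1 :: (g.word ++ y) := by
        rintro u' rfl hu'
        obtain ⟨hl, hw⟩ := ihs u' (fun t ht => ih t (by simp [ht])) hu'
        rw [graft.go, List.count_append, if_neg (by simp [leaves_eq_count]), leaves_eq_count,
          Nat.add_sub_cancel_left]
        simp [hl, hw]
      obtain ⟨u', hu, hv'⟩ | ⟨v', ht, hv'⟩ := List.append_eq_append_iff.1 h
      · exact later u' hu hv'
      · obtain _ | ⟨z, v'⟩ := v'
        · exact later [] (by simpa using ht.symm) (by simpa using hv'.symm)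
        simp only [List.cons_append, List.cons.injEq] at hv'
        obtain ⟨rfl, rfl⟩ := hv'
        rw [graft.go, if_pos (by simp [leaves_eq_count, ht])]
        simp [ih t (by simp) ht]

/-! ### Runs of the insertion algorithm and their inversion. -/

/-- `Insertion G L t u r` says that successively attaching the trees in `L` to `G`, where each tree
of `L` comes with the length of the preceding walk, produces the tree `t`, and that the vertices of
`t` before (from) the final position of the traversal have the outdegrees `u` (`r`). -/
inductive Insertion (G : OrderedTree) :
    List (ℕ × OrderedTree) → OrderedTree → List ℕ → List ℕ → Prop
  | init (hG : G.NoUnary) : Insertion G [] G [] G.word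
  | step {L : List (ℕ × OrderedTree)} {t g : OrderedTree} {u x y : List ℕ}
      (h : Insertion G L t u (x ++ 0 :: y)) (hg : g.NoUnary) :
      Insertion G (L ++ [(x.count 0 + 1, g)]) (graft g t ((u ++ x).count 0)) (u ++ x ++ [1])
        (g.word ++ y)

namespace Insertion

variable {G t : OrderedTree} {L : List (ℕ × OrderedTree)} {u r : List ℕ}

theorem word_eq (h : Insertion G L t u r) : t.word = u ++ r := by
  induction h with
  | init hG => rfl
  | step h hg ih =>
    rw [word_graft (u := _ ++ _) _ _ (by rw [ih, List.append_assoc])]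
    simp

/-- All unary vertices come from grafting and precede the position; this is what makes the last
graft recognizable. -/
theorem one_notMem (h : Insertion G L t u r) : 1 ∉ r := by
  induction h with
  | init hG => exact (noUnary_iff _).1 hG
  | step h hg ih =>
    have := (noUnary_iff _).1 hg
    simp_all

theorem count_pos (h : Insertion G L t u r) : 0 < r.count 0 := by
  cases h with
  | init hG => rw [← leaves_eq_count]; exact leaves_pos _
  | @step _ _ g h hg =>
    have := leaves_pos g
    rw [leaves_eq_count] at this
    rw [List.count_append]; omega

theorem noUnary (h : Insertion G L t u r) : G.NoUnary ∧ ∀ x ∈ L, x.2.NoUnary := by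
  induction h with
  | init hG => simpa
  | step h hg ih =>
    refine ⟨ih.1, fun x hx => ?_⟩
    rcases List.mem_append.1 hx with hx | hx
    · exact ih.2 x hx
    · rw [List.mem_singleton.1 hx]; exact hg

theorem one_le (h : Insertion G L t u r) : ∀ x ∈ L, 1 ≤ x.1 := by
  induction h with
  | init hG => simp
  | step h hg ih =>
    intro x hx
    rcases List.mem_append.1 hx with hx | hx
    · exact ih x hx
    · rw [List.mem_singleton.1 hx]; simp

theorem foldl_eq (h : Insertion G L t u r) :
    L.foldl ColoredDyckPath.insertStep (G, 0) = (t, u.count 0) := by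
  induction h with
  | init hG => rfl
  | step h hg ih => simp [ih, ColoredDyckPath.insertStep]

theorem generators_eq (h : Insertion G L t u r) :
    t.generators = G.leaves + (L.map fun x => x.2.leaves).sum := by
  induction h with
  | init hG =>
    simp [generators_eq_count, leaves_eq_count, List.count_eq_zero.2 ((noUnary_iff _).1 hG)]
  | step h hg ih =>
    have e := h.word_eq
    rw [generators_eq_count, word_graft (u := _ ++ _) _ _ (by rw [e, List.append_assoc])]
    rw [generators_eq_count, e] at ih
    simp [leaves_eq_count, List.count_eq_zero.2 ((noUnary_iff _).1 hg)] at ih ⊢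
    omega

theorem append_singleton_append_inj {α : Type*} {a : α} {u u' r r' : List α} (hr : a ∉ r)
    (hr' : a ∉ r') (h : u ++ [a] ++ r = u' ++ [a] ++ r') : u = u' ∧ r = r' := by
  simp only [List.append_assoc] at h
  obtain ⟨z, h1, h2⟩ | ⟨z, h1, h2⟩ := List.append_eq_append_iff.1 h <;>
    obtain _ | ⟨b, z⟩ := z <;> simp_all

/-- Both runs cut the word after its last 1. The prefix code then identifies the last grafted tree
and the remainder, hence the tree before the graft, and induction applies. -/
theorem inj (h : Insertion G L t u r) : ∀ {G' L' u' r'}, Insertion G' L' t u' r' →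
    G = G' ∧ L = L' ∧ r = r' := by
  induction h with
  | init hG =>
    intro G' L' u' r' h'
    have h1 := (noUnary_iff _).1 hG
    have h2 := h'.word_eq
    cases h' with
    | init hG' => simp
    | step h' hg =>
      rw [h2] at h1
      simp at h1
  | @step L t g u x y h hg ih =>
    intro G' L' u' r' h'
    have e := (h.step hg).word_eq
    have n := (h.step hg).one_notMem
    generalize ht : graft g t ((u ++ x).count 0) = s at *
    cases h' with
    | init hG' =>
      have := (noUnary_iff _).1 hG'
      simp [e] at this
    | @step L' t' g' u' x' y' h' hg' =>
      have e' := (h'.step hg').word_eq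
      have n' := (h'.step hg').one_notMem
      obtain ⟨h1, h2⟩ := append_singleton_append_inj n n' (e.symm.trans e')
      obtain ⟨rfl, rfl⟩ := word_append_inj _ h2
      have : t = t' := word_injective <| by
        rw [h.word_eq, h'.word_eq, ← List.append_assoc, h1, List.append_assoc]
      subst this
      obtain ⟨rfl, rfl, h3⟩ := ih h'
      -- The earlier positions are preceded by equally many leaves, and so are the grafting points;
      -- hence the last walks have equal length.
      have h4 := congrArg Prod.snd (h.foldl_eq.symm.trans h'.foldl_eq)
      have h5 := congrArg (List.count 0) h1
      simp only [List.count_append] at h4 h5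
      refine ⟨rfl, ?_, rfl⟩
      simp; omega

theorem exists_split {α : Type*} [DecidableEq α] (a : α) (w : List α) :
    ∃ u x, w = u ++ x ∧ a ∉ x ∧ (u = [] ∨ ∃ v, u = v ++ [a]) := by
  induction w using List.reverseRecOn with
  | nil => exact ⟨[], [], by simp⟩
  | append_singleton w b ih =>
    by_cases hb : b = a
    · exact ⟨w ++ [b], [], by simp, by simp, .inr ⟨w, by rw [hb]⟩⟩
    · obtain ⟨u, x, rfl, hx, hu⟩ := ih
      exact ⟨u, x ++ [b], by simp, by simp [hx, Ne.symm hb], hu⟩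

/-- Induction on the number of unary vertices: pruning below the last one turns it back into a leaf.
-/
theorem exists_of_word_eq (k : ℕ) : ∀ {t : OrderedTree} {u r : List ℕ}, u.count 1 = k →
    t.word = u ++ r → 1 ∉ r → (u = [] ∨ ∃ v, u = v ++ [1]) → ∃ G L, Insertion G L t u r := by
  induction k with
  | zero =>
    intro t u r hk hw hr hu
    obtain rfl | ⟨v, rfl⟩ := hu
    · obtain rfl : t.word = r := by simpa using hw
      exact ⟨t, [], .init ((noUnary_iff _).2 hr)⟩
    · simp at hk
  | succ k ih =>
    intro t u r hk hw hr hu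
    obtain rfl | ⟨v, rfl⟩ := hu
    · simp at hk
    rw [List.append_assoc] at hw
    -- The subtree at the last unary vertex has a single child `g`, the tree grafted last.
    obtain ⟨⟨ts⟩, y, hg, hrep⟩ := exists_subtree t hw (by simp)
    simp only [word_node, List.cons_append, List.cons.injEq, List.nil_append] at hg
    obtain ⟨hl, hg⟩ := hg
    obtain ⟨g, rfl⟩ := List.length_eq_one_iff.1 hl.symm
    simp only [forestWord_cons, forestWord_nil, List.append_nil] at hg
    subst hg
    obtain ⟨t', ht'⟩ := hrep (node [])
    simp at ht'
    obtain ⟨u, x, rfl, hx, hu⟩ := exists_split 1 v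
    obtain ⟨G, L, h⟩ := ih (t := t') (u := u) (r := x ++ 0 :: y)
      (by simpa [List.count_eq_zero.2 hx] using hk) (by simpa using ht')
      (by simpa [hx] using fun h => hr (by simp [h])) hu
    have hs := h.step (g := g) ((noUnary_iff _).2 fun h => hr (by simp [h]))
    have : t = graft g t' ((u ++ x).count 0) := word_injective <| by
      rw [hw, hs.word_eq]; simp
    exact ⟨G, _, this ▸ hs⟩

theorem exists_of_tree (t : OrderedTree) : ∃ G L u r, Insertion G L t u r := by
  obtain ⟨u, r, h, hr, hu⟩ := exists_split 1 t.word
  obtain ⟨G, L, h⟩ := exists_of_word_eq _ rfl h hr hu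
  exact ⟨G, L, u, r, h⟩

end Insertion

end OrderedTree

/-! ### Counting the colours by Schröder numbers. -/

namespace OrderedTree

/-- The lists of trees without vertices of outdegree 1 that have `j` leaves in total. -/
def SchroderForest (j : ℕ) : Type :=
  {ts : List OrderedTree // (ts.map leaves).sum = j ∧ ∀ t ∈ ts, t.NoUnary}

theorem card_schroderTree_one : Nat.card (SchroderTree 1) = 1 := by
  have key : ∀ t : OrderedTree, t.leaves = 1 → t.NoUnary → t = node [] := by
    rintro ⟨_ | ⟨a, _ | ⟨b, ts⟩⟩⟩ h1 h2
    · rfl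
    · simp [noUnary_node] at h2
    · have := a.leaves_pos
      have := b.leaves_pos
      rw [leaves_node_cons] at h1
      simp at h1; omega
  rw [Nat.card_eq_one_iff_unique]
  exact ⟨⟨fun a b => Subtype.ext ((key _ a.2.1 a.2.2).trans (key _ b.2.1 b.2.2).symm)⟩,
    ⟨⟨node [], by simp, by simp [noUnary_node]⟩⟩⟩

/-- A tree without vertices of outdegree 1, as a forest with one tree. -/
def SchroderForest.singleton {j : ℕ} (t : SchroderTree j) : SchroderForest j :=
  ⟨[t.1], by simp [t.2.1], by simp [t.2.2]⟩

theorem SchroderForest.singleton_injective {j : ℕ} :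
    Function.Injective (singleton (j := j)) := fun a b h => by
  exact Subtype.ext (List.singleton_injective (congrArg Subtype.val h))

theorem card_schroderForest_one : Nat.card (SchroderForest 1) = 1 := by
  refine Eq.trans ?_ card_schroderTree_one
  refine (Nat.card_congr (Equiv.ofBijective SchroderForest.singleton
    ⟨SchroderForest.singleton_injective, ?_⟩)).symm
  rintro ⟨_ | ⟨a, _ | ⟨b, ts⟩⟩, h1, h2⟩
  · simp at h1
  · exact ⟨⟨a, by simpa using h1, by simpa using h2⟩, rfl⟩
  · have := a.leaves_pos
    have := b.leaves_pos
    simp at h1; omega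

/-- The forest of the subtrees hanging from the root of a tree with at least two leaves. -/
def SchroderForest.children {j : ℕ} (t : SchroderTree (j + 2)) : SchroderForest (j + 2) :=
  match t with
  | ⟨node [], h⟩ => by simp at h
  | ⟨node (a :: ts), h⟩ => ⟨a :: ts, by rw [← leaves_node_cons, h.1], ((noUnary_node _).1 h.2).2⟩

theorem SchroderForest.node_children {j : ℕ} (t : SchroderTree (j + 2)) :
    node (children t).1 = t.1 := by
  obtain ⟨⟨_ | ⟨a, ts⟩⟩, h⟩ := t
  · simp at h
  · rfl

/-- A forest is either a single tree or has several trees, which a new root joins without becoming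
unary. This is the factor 2 between large and little Schröder numbers. -/
theorem SchroderForest.bijective_elim (j : ℕ) :
    Function.Bijective (Sum.elim (singleton (j := j + 2)) (children (j := j))) := by
  constructor
  · refine singleton_injective.sumElim (fun a b h => ?_) (fun a b h => ?_)
    · exact Subtype.ext (by rw [← node_children, h, node_children])
    · have hb := ((noUnary_node _).1 ((node_children b).symm ▸ b.2.2)).1
      rw [← h] at hb
      exact hb rfl
  · rintro ⟨_ | ⟨a, _ | ⟨b, ts⟩⟩, h1, h2⟩
    · simp at h1
    · exact ⟨.inl ⟨a, by simpa using h1, by simpa using h2⟩, rfl⟩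
    · exact ⟨.inr ⟨node (a :: b :: ts), by rw [leaves_node_cons, h1],
        (noUnary_node _).2 ⟨by simp, h2⟩⟩, rfl⟩

/-- The tree whose root has a given first subtree and a given nonempty forest of other subtrees. -/
def schroderTreeCons (j : ℕ)
    (x : Σ i : Fin (j + 1), SchroderTree (i + 1) × SchroderForest (j + 1 - i)) :
    SchroderTree (j + 2) :=
  ⟨node (x.2.1.1 :: x.2.2.1), by
    rw [leaves_node_cons, List.map_cons, List.sum_cons, x.2.1.2.1, x.2.2.2.1]; omega, by
    refine (noUnary_node _).2 ⟨fun h => ?_, by simpa using ⟨x.2.1.2.2, x.2.2.2.2⟩⟩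
    have := x.2.2.2.1
    rw [List.eq_nil_of_length_eq_zero (l := x.2.2.1) (by simpa using h)] at this
    simp at this; omega⟩

theorem schroderTreeCons_bijective (j : ℕ) : Function.Bijective (schroderTreeCons j) := by
  constructor
  · rintro ⟨⟨i, hi⟩, ⟨a, ha⟩, ⟨ts, hts⟩⟩ ⟨⟨i', hi'⟩, ⟨a', ha'⟩, ⟨ts', hts'⟩⟩ h
    obtain ⟨rfl, rfl⟩ : a = a' ∧ ts = ts' := by
      simpa using show node (a :: ts) = node (a' :: ts') from congrArg Subtype.val h
    obtain rfl : i = i' := by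
      have h1 := ha.1
      have h2 := ha'.1
      simp at h1 h2
      omega
    rfl
  · rintro ⟨⟨_ | ⟨a, ts⟩⟩, h1, h2⟩
    · simp at h1
    obtain ⟨h3, h4⟩ := (noUnary_node _).1 h2
    rw [leaves_node_cons, List.map_cons, List.sum_cons] at h1
    have ha := a.leaves_pos
    have hts : 0 < (ts.map leaves).sum := by
      obtain _ | ⟨b, ts⟩ := ts
      · simp at h3
      · have := b.leaves_pos
        simp; omega
    exact ⟨⟨⟨a.leaves - 1, by omega⟩, ⟨a, by simp; omega, h4 a (by simp)⟩,
      ⟨ts, by simp; omega, fun t ht => h4 t (by simp [ht])⟩⟩, rfl⟩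

theorem card_schroderForest_add_two (j : ℕ) [Finite (SchroderTree (j + 2))] :
    Nat.card (SchroderForest (j + 2)) = 2 * Nat.card (SchroderTree (j + 2)) := by
  rw [← Nat.card_congr (Equiv.ofBijective _ (SchroderForest.bijective_elim j)), Nat.card_sum]
  omega

theorem finite_schroder (j : ℕ) :
    Finite (SchroderTree (j + 1)) ∧ Finite (SchroderForest (j + 1)) := by
  induction j using Nat.strong_induction_on with
  | _ j ih =>
    obtain _ | j := j
    · exact ⟨Nat.finite_of_card_ne_zero (by rw [card_schroderTree_one]; simp),
        Nat.finite_of_card_ne_zero (by rw [card_schroderForest_one]; simp)⟩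
    have hT : Finite (SchroderTree (j + 2)) := by
      have (i : Fin (j + 1)) :
          Finite (SchroderTree (i + 1) × SchroderForest (j + 1 - i)) := by
        have := (ih i i.2).1
        have := (ih (j - i) (by omega)).2
        rw [show j - i + 1 = j + 1 - i by omega] at this
        infer_instance
      exact Finite.of_surjective _ (schroderTreeCons_bijective j).2
    exact ⟨hT, Finite.of_surjective _ (SchroderForest.bijective_elim j).2⟩

theorem card_schroderTree_add_two (j : ℕ) : Nat.card (SchroderTree (j + 2)) =
    ∑ i ∈ Finset.range (j + 1),
      Nat.card (SchroderTree (i + 1)) * Nat.card (SchroderForest (j - i + 1)) := by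
  have (i : Fin (j + 1)) : Finite (SchroderTree (i + 1) × SchroderForest (j + 1 - i)) := by
    have := (finite_schroder i).1
    have := (finite_schroder (j - i)).2
    rw [show j - i + 1 = j + 1 - i by omega] at this
    infer_instance
  rw [← Nat.card_congr (Equiv.ofBijective _ (schroderTreeCons_bijective j)), Nat.card_sigma,
    ← Fin.sum_univ_eq_sum_range (fun i => Nat.card (SchroderTree (i + 1)) *
      Nat.card (SchroderForest (j - i + 1)))]
  refine Finset.sum_congr rfl fun i _ => ?_
  rw [Nat.card_prod, show j - i + 1 = j + 1 - i by omega]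

theorem card_schroderForest (j : ℕ) : Nat.card (SchroderForest (j + 1)) = Nat.largeSchroder j := by
  induction j using Nat.strong_induction_on with
  | _ j ih =>
    obtain _ | j := j
    · simp [card_schroderForest_one]
    have := (finite_schroder (j + 1)).1
    rw [card_schroderForest_add_two, card_schroderTree_add_two, Nat.largeSchroder_succ,
      ← Nat.range_succ_eq_Iic, Finset.sum_range_succ', Finset.sum_range_succ', mul_add,
      Finset.mul_sum, card_schroderTree_one]
    -- For a first subtree with at least two leaves the factor 2 converts trees into forests. The
    -- one-leaf term gives twice `Nat.largeSchroder j`: the separate summand of the recurrence and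
    -- its `i = 0` term.
    have : ∀ i ∈ Finset.range j, 2 * (Nat.card (SchroderTree (i + 1 + 1)) *
        Nat.card (SchroderForest (j - (i + 1) + 1))) =
        Nat.largeSchroder (i + 1) * Nat.largeSchroder (j - (i + 1)) := by
      intro i hi
      have := (finite_schroder (i + 1)).1
      rw [Finset.mem_range] at hi
      rw [← mul_assoc, ← card_schroderForest_add_two, ih (i + 1) (by omega), ih _ (by omega)]
    rw [Finset.sum_congr rfl this, Nat.sub_zero, ih j (by omega), Nat.largeSchroder_zero]
    omega

theorem card_schroderTree (j : ℕ) : Nat.card (SchroderTree (j + 1)) = littleSchroder j := by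
  obtain _ | j := j
  · simp [card_schroderTree_one, littleSchroder]
  · have := (finite_schroder (j + 1)).1
    have h := card_schroderForest_add_two j
    rw [card_schroderForest, ← Nat.two_mul_smallSchroder_succ (by simp)] at h
    exact (Nat.eq_of_mul_eq_mul_left two_pos h).symm

end OrderedTree

/-! ### Dyck paths as alternating runs. -/

namespace DyckWord

open DyckStep

/-- The lattice path consisting of `a` up-steps and, for each `x` in `L`, of `x.1` down-steps and
`x.2` up-steps. -/
def zigzag (a : ℕ) (L : List (ℕ × ℕ)) : List DyckStep :=
  List.replicate a U ++ L.flatMap fun x => List.replicate x.1 D ++ List.replicate x.2 U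

@[simp] theorem zigzag_nil (a : ℕ) : zigzag a [] = List.replicate a U := by
  simp [zigzag]

theorem zigzag_cons (a : ℕ) (x : ℕ × ℕ) (L : List (ℕ × ℕ)) :
    zigzag a (x :: L) = List.replicate a U ++ (List.replicate x.1 D ++ zigzag x.2 L) := by
  simp [zigzag]

theorem zigzag_append_singleton (a : ℕ) (L : List (ℕ × ℕ)) (x : ℕ × ℕ) :
    zigzag a (L ++ [x]) = zigzag a L ++ List.replicate x.1 D ++ List.replicate x.2 U := by
  simp [zigzag]

theorem count_U_zigzag (a : ℕ) (L : List (ℕ × ℕ)) :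
    (zigzag a L).count U = a + (L.map Prod.snd).sum := by
  induction L generalizing a with
  | nil => simp
  | cons x L ih => simp [zigzag_cons, ih, List.count_replicate]

theorem splitBy_replicate_append (s s' : DyckStep) (hs : s ≠ s') (a : ℕ) (w : List DyckStep)
    (hw : w.head? = some s') :
    (List.replicate (a + 1) s ++ w).splitBy (fun a b => a == b) =
      List.replicate (a + 1) s :: w.splitBy (fun a b => a == b) := by
  rw [List.splitBy_append, List.splitBy_of_isChain (by simp)]
  · rfl
  · exact List.isChain_replicate_of_rel _ (by simp)
  · simp [hw, List.getLast?_replicate, hs]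

theorem runs_zigzag (s : DyckStep) (b : ℕ) (L : List (ℕ × ℕ)) : ∀ (a : ℕ), 1 ≤ a → 1 ≤ b →
    (∀ x ∈ L, 1 ≤ x.1 ∧ 1 ≤ x.2) →
    (((zigzag a L ++ List.replicate b D).splitBy (fun a b => a == b)).filter
      (fun r => s ∈ r)).map List.length =
    match s with
    | U => a :: L.map Prod.snd
    | D => L.map Prod.fst ++ [b] := by
  obtain _ | b := b
  · simp
  induction L with
  | nil =>
    rintro (_ | a) ha - -
    · simp at ha
    rw [zigzag_nil, splitBy_replicate_append U D (by simp) a _ (by simp [List.replicate_succ]),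
      List.splitBy_of_isChain (by simp) (List.isChain_replicate_of_rel _ (by simp))]
    cases s <;> simp
  | cons x L ih =>
    rintro (_ | a) ha hb h
    · simp at ha
    obtain ⟨_ | d, _ | c⟩ := x
    · simp at h
    · simp at h
    · simp at h
    rw [zigzag_cons, List.append_assoc, List.append_assoc,
      splitBy_replicate_append U D (by simp) a _ (by simp [List.replicate_succ]),
      splitBy_replicate_append D U (by simp) d _ (by simp [zigzag, List.replicate_succ])]
    have := ih (c + 1) (by simp) hb (fun x hx => h x (by simp [hx]))
    cases s <;> simp at this ⊢ <;> exact this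

theorem one_le_of_mem_ascents {p : DyckWord} {a : ℕ} (h : a ∈ p.ascents) : 1 ≤ a := by
  obtain ⟨r, hr, rfl⟩ := List.mem_map.1 h
  exact List.length_pos_of_mem (of_decide_eq_true (List.mem_filter.1 hr).2)

theorem ascents_eq {p : DyckWord} {a b : ℕ} {L : List (ℕ × ℕ)} (ha : 1 ≤ a) (hb : 1 ≤ b)
    (h : ∀ x ∈ L, 1 ≤ x.1 ∧ 1 ≤ x.2) (hp : p.toList = zigzag a L ++ List.replicate b D) :
    p.ascents = a :: L.map Prod.snd := by
  rw [ascents, runLengths, hp]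
  exact runs_zigzag U b L a ha hb h

theorem descents_eq {p : DyckWord} {a b : ℕ} {L : List (ℕ × ℕ)} (ha : 1 ≤ a) (hb : 1 ≤ b)
    (h : ∀ x ∈ L, 1 ≤ x.1 ∧ 1 ≤ x.2) (hp : p.toList = zigzag a L ++ List.replicate b D) :
    p.descents = L.map Prod.fst ++ [b] := by
  rw [descents, runLengths, hp]
  exact runs_zigzag D b L a ha hb h

/-- Leading down-steps are allowed so that the induction can prepend one step at a time. -/
theorem exists_zigzag_of_concat (w : List DyckStep) :
    (∃ c, w ++ [D] = List.replicate (c + 1) D) ∨ ∃ c a b L, 1 ≤ a ∧ 1 ≤ b ∧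
      (∀ x ∈ L, 1 ≤ x.1 ∧ 1 ≤ x.2) ∧
      w ++ [D] = List.replicate c D ++ (zigzag a L ++ List.replicate b D) := by
  induction w with
  | nil => exact .inl ⟨0, by simp⟩
  | cons s w ih =>
    obtain ⟨c, hw⟩ | ⟨c, a, b, L, ha, hb, hL, hw⟩ := ih <;> rw [List.cons_append, hw] <;> cases s
    · exact .inr ⟨0, 1, c + 1, [], by simp, by simp, by simp, by simp⟩
    · exact .inl ⟨c + 1, by simp [List.replicate_succ]⟩
    · obtain _ | c := c
      · exact .inr ⟨0, a + 1, b, L, by simp, hb, hL, by simp [zigzag, List.replicate_succ]⟩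
      -- A new up-step closes off the leading descent, which is paired with the former first ascent.
      · exact .inr ⟨0, 1, b, (c + 1, a) :: L, by simp, hb, by simpa [ha] using hL,
          by simp [zigzag_cons]⟩
    · exact .inr ⟨c + 1, a, b, L, ha, hb, hL, by simp [List.replicate_succ]⟩

theorem exists_zigzag (p : DyckWord) (hp : p ≠ 0) : ∃ a b L, 1 ≤ a ∧ 1 ≤ b ∧
    (∀ x ∈ L, 1 ≤ x.1 ∧ 1 ≤ x.2) ∧ p.toList = zigzag a L ++ List.replicate b D := by
  have h := cons_tail_dropLast_concat hp
  obtain ⟨c, hw⟩ | ⟨c, a, b, L, ha, hb, hL, hw⟩ :=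
    exists_zigzag_of_concat (U :: p.toList.dropLast.tail)
  · simp [List.replicate_succ] at hw
  · obtain _ | c := c
    · exact ⟨a, b, L, ha, hb, hL, by simpa [h] using hw⟩
    · simp [List.replicate_succ] at hw

/-- Every prefix of the path has at least as many up-steps as down-steps. -/
def IsBallot (w : List DyckStep) : Prop := ∀ i, (w.take i).count D ≤ (w.take i).count U

theorem IsBallot.of_append {v w : List DyckStep} (h : IsBallot (v ++ w)) : IsBallot v := fun i => by
  have := h (min i v.length)
  rwa [List.take_append_of_le_length (by simp), ← List.take_take, List.take_length] at this

theorem IsBallot.count_le {w : List DyckStep} (h : IsBallot w) : w.count D ≤ w.count U := by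
  simpa using h w.length

theorem isBallot_replicate (a : ℕ) : IsBallot (List.replicate a U) := fun i => by
  simp [List.take_replicate, List.count_replicate]

theorem IsBallot.append_up {w : List DyckStep} (h : IsBallot w) (a : ℕ) :
    IsBallot (w ++ List.replicate a U) := fun i => by
  have := h i
  simp [List.take_append, List.take_replicate, List.count_replicate]
  omega

theorem IsBallot.append_down {w : List DyckStep} (h : IsBallot w) {d : ℕ}
    (hd : w.count D + d ≤ w.count U) : IsBallot (w ++ List.replicate d D) := fun i => by
  have := h i
  simp only [List.take_append, List.take_replicate, List.count_append, List.count_replicate]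
  obtain hi | hi := le_total i w.length
  · simpa [Nat.sub_eq_zero_of_le hi] using this
  · rw [List.take_of_length_le hi]
    simp; omega

end DyckWord

/-! ### Feasibility of insertion and the ballot condition. -/

namespace OrderedTree

open DyckStep DyckWord

/-- The descent lengths in `L`, each paired with the length of the following ascent, which is
coloured by the accompanying tree. -/
def stepLengths (L : List (ℕ × OrderedTree)) : List (ℕ × ℕ) := L.map fun x => (x.1, x.2.leaves)

theorem one_le_stepLengths {L : List (ℕ × OrderedTree)} (h : ∀ x ∈ L, 1 ≤ x.1) :
    ∀ x ∈ stepLengths L, 1 ≤ x.1 ∧ 1 ≤ x.2 := by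
  intro x hx
  obtain ⟨y, hy, rfl⟩ := List.mem_map.1 hx
  exact ⟨h y hy, leaves_pos _⟩

/-- The height equals the number of leaves still ahead: a walk to the `d`-th leaf uses up `d` of
them, and the grafted tree adds its own. -/
theorem Insertion.isBallot {G t : OrderedTree} {L : List (ℕ × OrderedTree)} {u r : List ℕ}
    (h : Insertion G L t u r) : IsBallot (zigzag G.leaves (stepLengths L)) ∧
      (zigzag G.leaves (stepLengths L)).count U =
        (zigzag G.leaves (stepLengths L)).count D + r.count 0 := by
  induction h with
  | init hG =>
    simpa [stepLengths, List.count_replicate, leaves_eq_count] using isBallot_replicate _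
  | step h hg ih =>
    obtain ⟨h1, h2⟩ := ih
    simp only [stepLengths, List.map_append, List.map_cons, List.map_nil,
      zigzag_append_singleton] at h1 h2 ⊢
    simp only [List.count_append, List.count_cons_self] at h2
    refine ⟨(h1.append_down (by omega)).append_up _, ?_⟩
    simp only [← leaves_eq_count, List.count_append, List.count_replicate]
    simp
    omega

theorem exists_eq_append_cons_of_lt_count {α : Type*} [DecidableEq α] (a : α) (w : List α) :
    ∀ k, k < w.count a → ∃ x y, w = x ++ a :: y ∧ x.count a = k := by
  induction w with
  | nil => simp
  | cons b w ih =>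
    intro k hk
    by_cases hb : b = a
    · subst hb
      obtain _ | k := k
      · exact ⟨[], w, by simp⟩
      · obtain ⟨x, y, rfl, rfl⟩ := ih k (by simpa using hk)
        exact ⟨b :: x, y, by simp⟩
    · obtain ⟨x, y, rfl, rfl⟩ := ih k (by simpa [List.count_cons, hb] using hk)
      exact ⟨b :: x, y, by simp, by simp [hb]⟩

theorem exists_insertion_of_isBallot {G : OrderedTree} (hG : G.NoUnary)
    (L : List (ℕ × OrderedTree)) : (∀ x ∈ L, 1 ≤ x.1 ∧ x.2.NoUnary) →
    IsBallot (zigzag G.leaves (stepLengths L)) → ∃ t u r, Insertion G L t u r := by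
  induction L using List.reverseRecOn with
  | nil => exact fun _ _ => ⟨G, [], G.word, .init hG⟩
  | append_singleton L x ih =>
    intro hL h
    simp only [stepLengths, List.map_append, List.map_cons, List.map_nil,
      zigzag_append_singleton] at h
    obtain ⟨t, u, r, hi⟩ := ih (fun x hx => hL x (by simp [hx])) h.of_append.of_append
    have h1 := hi.isBallot.2
    have h2 := h.of_append.count_le
    obtain ⟨hx, hg⟩ := hL x (by simp)
    simp [List.count_replicate, stepLengths] at h1 h2
    -- Nonnegativity at the end of the descent guarantees `x.1` leaves ahead; the target leaf has
    -- `x.1 - 1` of them before it.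
    obtain ⟨v, y, rfl, hv⟩ := exists_eq_append_cons_of_lt_count 0 r (x.1 - 1) (by omega)
    have hs := hi.step hg
    rw [hv, Nat.sub_add_cancel hx] at hs
    exact ⟨_, _, _, hs⟩

end OrderedTree

/-! ### The bijection on coloured Dyck paths. -/

namespace ColoredDyckPath

open DyckStep DyckWord OrderedTree

variable {n : ℕ}

/-- The trees that colour the ascents of a path. -/
def colors (P : ColoredDyckPath SchroderTree n) : List OrderedTree :=
  List.ofFn fun i => (P.color i).1

theorem map_leaves_colors (P : ColoredDyckPath SchroderTree n) :
    P.colors.map leaves = P.path.ascents := by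
  rw [colors, List.map_ofFn]
  refine Eq.trans ?_ (List.ofFn_get P.path.ascents)
  exact congrArg List.ofFn (funext fun i => (P.color i).2.1)

theorem noUnary_of_mem_colors (P : ColoredDyckPath SchroderTree n) :
    ∀ g ∈ P.colors, g.NoUnary := by
  intro g hg
  obtain ⟨i, rfl⟩ := List.mem_ofFn.1 hg
  exact (P.color i).2.2

theorem ext_colors {P Q : ColoredDyckPath SchroderTree n} (h : P.path = Q.path)
    (hc : P.colors = Q.colors) : P = Q := by
  obtain ⟨p, hp, c⟩ := P
  obtain ⟨q, hq, d⟩ := Q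
  obtain rfl : p = q := h
  congr
  exact funext fun i => Subtype.ext (congrFun (List.ofFn_injective hc) i)

theorem exists_of_colors {p : DyckWord} (hp : p.semilength = n) {Gs : List OrderedTree}
    (h : Gs.map leaves = p.ascents) (hG : ∀ g ∈ Gs, g.NoUnary) :
    ∃ P : ColoredDyckPath SchroderTree n, P.path = p ∧ P.colors = Gs := by
  have hl : Gs.length = p.ascents.length := by rw [← h, List.length_map]
  refine ⟨⟨p, hp, fun i => ⟨Gs.get (i.cast hl.symm), ?_, hG _ (List.get_mem ..)⟩⟩, rfl, ?_⟩
  · simp [← h]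
  · exact List.ext_getElem (by simp [colors, hl]) (by simp [colors])

/-- `List.zip` truncates, which is how the unused last descent disappears. -/
theorem zip_map_append_singleton {α β : Type*} (L : List (α × β)) (b : α) :
    (L.map Prod.fst ++ [b]).zip (L.map Prod.snd) = L := by
  induction L with
  | nil => rfl
  | cons x L ih => simp [ih]

theorem toTree_eq {P : ColoredDyckPath SchroderTree n} {G t : OrderedTree}
    {L : List (ℕ × OrderedTree)} {u r : List ℕ} {b : ℕ} (h : Insertion G L t u r) (hb : 1 ≤ b)
    (hc : P.colors = G :: L.map Prod.snd)
    (hp : P.path.toList = zigzag G.leaves (stepLengths L) ++ List.replicate b D) :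
    P.toTree = t := by
  have hd := descents_eq G.leaves_pos hb (one_le_stepLengths h.one_le) hp
  rw [toTree, ← colors, hc, hd, insertAll]
  have : (stepLengths L).map Prod.fst = L.map Prod.fst := by simp [stepLengths]
  rw [this, zip_map_append_singleton, h.foldl_eq]

theorem exists_stepLengths_eq {Gs : List OrderedTree} : ∀ {L : List (ℕ × ℕ)},
    Gs.map leaves = L.map Prod.snd → ∃ L', L = stepLengths L' ∧ Gs = L'.map Prod.snd := by
  induction Gs with
  | nil => intro L h; exact ⟨[], by simpa [stepLengths] using h.symm, rfl⟩
  | cons g Gs ih =>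
    rintro (_ | ⟨x, L⟩) h
    · simp at h
    simp only [List.map_cons, List.cons.injEq] at h
    obtain ⟨L', rfl, rfl⟩ := ih h.2
    exact ⟨(x.1, g) :: L', by simp [stepLengths, h.1], rfl⟩

theorem exists_insertion (hn : 1 ≤ n) (P : ColoredDyckPath SchroderTree n) :
    ∃ G L u r b, Insertion G L P.toTree u r ∧ P.colors = G :: L.map Prod.snd ∧
      P.path.toList = zigzag G.leaves (stepLengths L) ++ List.replicate b D := by
  have h0 : P.path ≠ 0 := by
    intro h
    have := P.semilength_eq
    simp [h] at this
    omega
  obtain ⟨a, b, L, ha, hb, hL, hp⟩ := P.path.exists_zigzag h0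
  have hc := P.map_leaves_colors
  have hu := P.noUnary_of_mem_colors
  rw [ascents_eq ha hb hL hp] at hc
  rcases hG : P.colors with _ | ⟨G, Gs⟩
  · simp [hG] at hc
  rw [hG] at hc hu
  simp only [List.map_cons, List.cons.injEq] at hc
  obtain ⟨rfl, hc⟩ := hc
  obtain ⟨L, rfl, rfl⟩ := exists_stepLengths_eq hc
  have hbal : IsBallot P.path.toList := P.path.count_D_le_count_U
  rw [hp] at hbal
  obtain ⟨t, u, r, h⟩ := exists_insertion_of_isBallot (hu G (by simp)) L
    (fun x hx => ⟨(hL (x.1, x.2.leaves) (List.mem_map.2 ⟨x, hx, rfl⟩)).1,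
      hu _ (by simpa using .inr ⟨x.1, hx⟩)⟩) hbal.of_append
  obtain rfl := toTree_eq h hb hG hp
  exact ⟨G, L, u, r, b, h, rfl, hp⟩

theorem count_U_eq_generators {G t : OrderedTree} {L : List (ℕ × OrderedTree)} {u r : List ℕ}
    (h : Insertion G L t u r) (b : ℕ) :
    (zigzag G.leaves (stepLengths L) ++ List.replicate b D).count U = t.generators := by
  rw [h.generators_eq, List.count_append, count_U_zigzag]
  simp [stepLengths, List.count_replicate, Function.comp_def]

theorem bijOn_toTree (hn : 1 ≤ n) :
    Set.BijOn (toTree (n := n)) Set.univ {t : OrderedTree | t.generators = n} := by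
  refine ⟨fun P _ => ?_, fun P _ Q _ hPQ => ?_, fun t ht => ?_⟩
  · obtain ⟨G, L, u, r, b, h, -, hp⟩ := P.exists_insertion hn
    refine (count_U_eq_generators h b).symm.trans ?_
    rw [← hp]
    exact P.semilength_eq
  · obtain ⟨G, L, u, r, b, h, hc, hp⟩ := P.exists_insertion hn
    obtain ⟨G', L', u', r', b', h', hc', hp'⟩ := Q.exists_insertion hn
    obtain ⟨rfl, rfl, rfl⟩ := h.inj (hPQ ▸ h')
    refine ext_colors (DyckWord.ext ?_) (hc.trans hc'.symm)
    -- The run does not see the last descent; its length follows from the balance of up- and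
    -- down-steps.
    have h1 := P.path.count_U_eq_count_D
    have h2 := Q.path.count_U_eq_count_D
    rw [hp] at h1
    rw [hp'] at h2
    simp [List.count_replicate] at h1 h2
    rw [hp, hp', show b = b' by omega]
  · obtain ⟨G, L, u, r, h⟩ := Insertion.exists_of_tree t
    obtain ⟨h1, h2⟩ := h.isBallot
    -- The path stands at height `r.count 0` after its last ascent, so this descent closes it.
    let p : DyckWord := ⟨zigzag G.leaves (stepLengths L) ++ List.replicate (r.count 0) D,
      by simpa [List.count_replicate] using h2, h1.append_down h2.ge⟩
    obtain ⟨P, hp, hc⟩ := exists_of_colors (n := n) (p := p) (Gs := G :: L.map Prod.snd)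
      ((count_U_eq_generators h _).trans ht)
      (by rw [ascents_eq G.leaves_pos h.count_pos (one_le_stepLengths h.one_le) rfl]
          simp [stepLengths])
      (by simpa using ⟨h.noUnary.1, fun g d hg => h.noUnary.2 (d, g) hg⟩)
    exact ⟨P, trivial, toTree_eq h h.count_pos hc (by rw [hp])⟩

/-- Recolouring along a family of bijections between the sets of colours. -/
def congrColor {C C' : ℕ → Type} (e : ∀ j, 1 ≤ j → C j ≃ C' j) :
    ColoredDyckPath C n ≃ ColoredDyckPath C' n where
  toFun P := ⟨P.path, P.semilength_eq,
    fun i => e _ (one_le_of_mem_ascents (List.get_mem ..)) (P.color i)⟩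
  invFun P := ⟨P.path, P.semilength_eq,
    fun i => (e _ (one_le_of_mem_ascents (List.get_mem ..))).symm (P.color i)⟩
  left_inv P := by simp
  right_inv P := by simp

end ColoredDyckPath

theorem mainTheorem3 (n : ℕ) (hn : 1 ≤ n) :
    (∀ j : ℕ, 1 ≤ j → Nat.card (SchroderTree j) = littleSchroder (j - 1)) ∧
    Set.BijOn (ColoredDyckPath.toTree (n := n)) Set.univ {t : OrderedTree | t.generators = n} ∧
    Nonempty (ColoredDyckPath (fun j => Fin (littleSchroder (j - 1))) n ≃
      {t : OrderedTree // t.generators = n}) := by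
  have hcard : ∀ j : ℕ, 1 ≤ j → Nat.card (SchroderTree j) = littleSchroder (j - 1) := by
    rintro (_ | j) hj
    · simp at hj
    · exact OrderedTree.card_schroderTree j
  have hbij := ColoredDyckPath.bijOn_toTree hn
  -- Only `j ≥ 1` can be matched: `SchroderTree 0` is empty, while `littleSchroder (0 - 1)` is 1.
  refine ⟨hcard, hbij, ⟨(ColoredDyckPath.congrColor fun j hj => ?_).trans
    ((Equiv.Set.univ _).symm.trans (hbij.equiv _))⟩⟩
  have : Finite (SchroderTree j) := by
    obtain _ | j := j
    · simp at hj
    · exact (OrderedTree.finite_schroder j).1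
  exact (Finite.equivFinOfCardEq (hcard j hj)).symm
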